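/- All vector lattices are real and Archimedean. Let $X$ be an order complete vector lattice, i.e. every nonempty order bounded subset of $X$ has a supremum. If $X$ is uo-complete, then $X$ is universally complete. Conversely, if $X$ is universally complete and, in addition, has the countable sup property, then $X$ is uo-complete. Here a net $(x_\alpha)_{\alpha\in\Gamma}$ in $X$ converges in order to $x\in X$ if there is a net $(a_\gamma)_{\gamma\in\Lambda}$ in $X$, decreasing with infimum $0$ (written $a_\gamma\downarrow 0$), such that for every $\gamma\in\Lambda$ there is $\alpha_0\in\Gamma$ with $|x_\alpha-x|\le a_\gamma$ for all $\alpha\ge\alpha_0$. It uo-converges to $x$ if $|x_\alpha-x|\wedge y$ converges in order to $0$ for every $0\le y\in X$. It is uo-Cauchy if the doubly indexed net $(x_\alpha-x_{\alpha'})_{(\alpha,\alpha')\in\Gamma\times\Gamma}$ uo-converges to $0$, and $X$ is uo-complete if every uo-Cauchy net in $X$ uo-converges to an element of $X$. $X$ is laterally complete if every nonempty collection of mutually disjoint positive vectors in $X$ has a supremum, and universally complete if it is order complete and laterally complete. $X$ has the countable sup property if every subset of $X$ that has a supremum contains an at most countable subset with the same supremum. -/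

import Mathlib

universe u v

/- Throughout, a (real) vector lattice is a type `X` with the instances `[AddCommGroup X]`,
`[Lattice X]`, `[IsOrderedAddMonoid X]`, `[Module ℝ X]`, `[IsOrderedModule ℝ X]`.
A net in `X` is a function `x : ι → X` on a nonempty directed preordered set `ι`. -/

namespace VLat

section Nets

variable {X : Type u} [AddCommGroup X] [Lattice X]

/-- The net `x` converges in order to `l`: some net `a` with `a ↓ 0` eventually dominates
`|x i - l|`, in the sense that for every `γ` there is `i₀` with `|x i - l| ≤ a γ` for all `i ≥ i₀`.
The condition depends only on the set of values of `a`, which is itself a downward directed subset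
of `X`, so it is no restriction to take the index set of `a` in the universe of `X`. -/
def OrderConverges {ι : Type v} [Preorder ι] (x : ι → X) (l : X) : Prop :=
  ∃ (Γ : Type u) (_ : Preorder Γ) (_ : IsDirectedOrder Γ) (_ : Nonempty Γ) (a : Γ → X),
    Antitone a ∧ IsGLB (Set.range a) 0 ∧
      ∀ γ : Γ, ∃ i₀ : ι, ∀ i : ι, i₀ ≤ i → |x i - l| ≤ a γ

/-- The net `x` converges in unbounded order to `l`. -/
def UOConverges {ι : Type v} [Preorder ι] (x : ι → X) (l : X) : Prop :=
  ∀ y : X, 0 ≤ y → OrderConverges (fun i => |x i - l| ⊓ y) 0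

/-- The net `x` is uo-Cauchy: the doubly indexed net `x i - x j` on `ι × ι`, with the product
order, uo-converges to `0`. -/
def UOCauchy {ι : Type v} [Preorder ι] (x : ι → X) : Prop :=
  UOConverges (fun p : ι × ι => x p.1 - x p.2) 0

end Nets

section Spaces

variable (X : Type u) [AddCommGroup X] [Lattice X]

/-- Every uo-Cauchy net, indexed by a directed set in the universe `v`, is uo-convergent. -/
def UOComplete : Prop :=
  ∀ (ι : Type v) [Preorder ι] [IsDirectedOrder ι] [Nonempty ι] (x : ι → X),
    UOCauchy x → ∃ l : X, UOConverges x l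

/-- Every nonempty order bounded subset has a supremum. -/
def OrderComplete : Prop :=
  ∀ A : Set X, A.Nonempty → BddAbove A → BddBelow A → ∃ s : X, IsLUB A s

/-- Every nonempty collection of mutually disjoint positive vectors has a supremum. -/
def LaterallyComplete : Prop :=
  ∀ A : Set X, A.Nonempty → (∀ a ∈ A, 0 ≤ a) → A.Pairwise (fun a b => |a| ⊓ |b| = 0) →
    ∃ s : X, IsLUB A s

/-- Order complete and laterally complete. -/
def UniversallyComplete : Prop :=
  OrderComplete X ∧ LaterallyComplete X

/-- Every subset that has a supremum has an at most countable subset with the same supremum. -/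
def CountableSupProperty : Prop :=
  ∀ (A : Set X) (s : X), IsLUB A s → ∃ C : Set X, C ⊆ A ∧ C.Countable ∧ IsLUB C s

end Spaces

end VLat

/-! Finite sums of a disjoint positive family increase. Truncated at `y` they have a supremum `u`,
and `u` minus the truncated sums dominates all later differences, so the net is uo-Cauchy. A
monotone uo-limit is a supremum.

Conversely, lateral completeness yields a weak unit `e`, and testing on `e` suffices. The countable
sup property replaces the dominating net by a sequence `b n ↓ 0`, hence the net by a sequence `y`.
The crux is that `y` is order bounded: on the band of `(e - b n)⁺` later terms stay within `e` of `y
n`, and these local bounds glue by lateral completeness. The limit inferior of `y` is then the limit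
of the net. -/

namespace VLat

/-! ### Distributivity, disjointness and band components -/

section LatticeOrderedGroup

variable {X : Type u} [AddCommGroup X] [Lattice X] [IsOrderedAddMonoid X]

theorem inf_le_of_isLUB {A : Set X} {s y c : X} (hs : IsLUB A s) (h : ∀ a ∈ A, a ⊓ y ≤ c) :
    s ⊓ y ≤ c := by
  have h1 : s ≤ c + s ⊔ y - y := by
    refine hs.2 fun a ha => ?_
    have h2 : a ⊓ y + a ⊔ y ≤ c + s ⊔ y :=
      add_le_add (h a ha) (sup_le_sup_right (hs.1 ha) y)
    rw [inf_add_sup] at h2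
    exact le_sub_iff_add_le.mpr h2
  have h3 : s ⊓ y + s ⊔ y ≤ c + s ⊔ y := by
    rw [inf_add_sup]
    exact le_sub_iff_add_le.mp h1
  exact le_of_add_le_add_right h3

theorem inf_add_le_add_inf {x y z : X} (hx : 0 ≤ x) (hy : 0 ≤ y) (hz : 0 ≤ z) :
    x ⊓ (y + z) ≤ x ⊓ y + x ⊓ z := by
  rw [add_inf]
  refine le_inf (inf_le_left.trans (le_add_of_nonneg_left (le_inf hx hy))) ?_
  rw [inf_add]
  exact le_inf (inf_le_left.trans (le_add_of_nonneg_right hz)) inf_le_right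

theorem inf_add_eq_zero {x y z : X} (hx : 0 ≤ x) (hy : 0 ≤ y) (hz : 0 ≤ z)
    (hxy : x ⊓ y = 0) (hxz : x ⊓ z = 0) : x ⊓ (y + z) = 0 :=
  le_antisymm ((inf_add_le_add_inf hx hy hz).trans (by rw [hxy, hxz, add_zero]))
    (le_inf hx (add_nonneg hy hz))

theorem inf_nsmul_eq_zero {x y : X} (hx : 0 ≤ x) (hy : 0 ≤ y) (h : x ⊓ y = 0) (n : ℕ) :
    x ⊓ n • y = 0 := by
  induction n with
  | zero => simpa using hx
  | succ n ih =>
    rw [succ_nsmul]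
    exact inf_add_eq_zero hx (nsmul_nonneg hy n) hy ih h

omit [IsOrderedAddMonoid X] in
theorem inf_eq_zero_mono {x y x' y' : X} (hx : 0 ≤ x) (hy : 0 ≤ y) (hxx : x ≤ x') (hyy : y ≤ y')
    (h : x' ⊓ y' = 0) : x ⊓ y = 0 :=
  le_antisymm ((inf_le_inf hxx hyy).trans h.le) (le_inf hx hy)

theorem add_eq_sup_of_inf_eq_zero {x y : X} (h : x ⊓ y = 0) : x + y = x ⊔ y := by
  rw [← inf_add_sup x y, h, zero_add]

theorem inf_sum_eq_zero {ι : Type*} {f : ι → X} (hf : ∀ i, 0 ≤ f i) {a : X} (ha : 0 ≤ a)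
    (s : Finset ι) (h : ∀ i ∈ s, a ⊓ f i = 0) : a ⊓ ∑ i ∈ s, f i = 0 := by
  classical
  induction s using Finset.induction_on with
  | empty => simpa using ha
  | insert i s hi ih =>
    rw [Finset.sum_insert hi]
    exact inf_add_eq_zero ha (hf i) (Finset.sum_nonneg fun j _ => hf j)
      (h i (Finset.mem_insert_self i s)) (ih fun j hj => h j (Finset.mem_insert_of_mem hj))

omit [AddCommGroup X] [IsOrderedAddMonoid X] in
theorem OrderComplete.exists_isLUB (hX : OrderComplete X) {A : Set X} (hA : A.Nonempty)
    (hb : BddAbove A) : ∃ s, IsLUB A s := by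
  obtain ⟨a₀, ha₀⟩ := hA
  obtain ⟨u, hu⟩ := hb
  obtain ⟨s, hs⟩ := hX ((fun a => a ⊔ a₀) '' A) ⟨_, a₀, ha₀, rfl⟩
    ⟨u, by rintro _ ⟨a, ha, rfl⟩; exact sup_le (hu ha) (hu ha₀)⟩
    ⟨a₀, by rintro _ ⟨a, _, rfl⟩; exact le_sup_right⟩
  refine ⟨s, fun a ha => le_sup_left.trans (hs.1 ⟨a, ha, rfl⟩), fun w hw => hs.2 ?_⟩
  rintro _ ⟨a, ha, rfl⟩
  exact sup_le (hw ha) (hw ha₀)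

/-- A positive `x` splits into a part in the band generated by `v` and a part disjoint
from `v`. -/
theorem OrderComplete.exists_band_component (hX : OrderComplete X) {v x : X} (hv : 0 ≤ v)
    (hx : 0 ≤ x) :
    ∃ p, 0 ≤ p ∧ p ≤ x ∧ (x - p) ⊓ v = 0 ∧ ∀ t, 0 ≤ t → t ⊓ v = 0 → t ⊓ p = 0 := by
  obtain ⟨p, hp⟩ := hX.exists_isLUB (A := Set.range fun n : ℕ => x ⊓ n • v) (Set.range_nonempty _)
    ⟨x, by rintro _ ⟨n, rfl⟩; exact inf_le_left⟩
  have hp0 : 0 ≤ p := by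
    simpa [hx] using hp.1 ⟨0, rfl⟩
  have hpx : p ≤ x := hp.2 (by rintro _ ⟨n, rfl⟩; exact inf_le_left)
  refine ⟨p, hp0, hpx, le_antisymm ?_ (le_inf (sub_nonneg.mpr hpx) hv), fun t ht htv => ?_⟩
  -- Adding `(x - p) ⊓ v` to `x ⊓ n • v` stays below `x ⊓ (n + 1) • v`, hence below `p`.
  · have h : p ≤ p - (x - p) ⊓ v := by
      refine hp.2 ?_
      rintro _ ⟨n, rfl⟩
      refine le_sub_iff_add_le.mpr (le_trans (le_inf ?_ ?_) (hp.1 ⟨n + 1, rfl⟩))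
      · exact (add_le_add (hp.1 ⟨n, rfl⟩) inf_le_left).trans (by simp)
      · rw [succ_nsmul]
        exact add_le_add inf_le_right inf_le_right
    simpa using h
  · rw [inf_comm]
    refine le_antisymm (inf_le_of_isLUB hp ?_) (le_inf hp0 ht)
    rintro _ ⟨n, rfl⟩
    calc x ⊓ n • v ⊓ t ≤ t ⊓ n • v := le_inf inf_le_right (inf_le_left.trans inf_le_right)
      _ = 0 := inf_nsmul_eq_zero ht hv htv n
      _ ≤ 0 := le_rfl

end LatticeOrderedGroup

/-! ### From uo-completeness to lateral completeness -/

section LateralCompleteness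

variable {X : Type u} [AddCommGroup X] [Lattice X] [IsOrderedAddMonoid X]

/-- The increasing net of finite sums of a disjoint family is uo-Cauchy. -/
theorem OrderComplete.uoCauchy_sum (hX : OrderComplete X) {ι : Type u} {f : ι → X}
    (hf : ∀ i, 0 ≤ f i) (hd : Pairwise fun i j => f i ⊓ f j = 0) :
    UOCauchy fun s : Finset ι => ∑ i ∈ s, f i := by
  classical
  intro y hy
  obtain ⟨u, hu⟩ := hX.exists_isLUB (A := Set.range fun s : Finset ι => (∑ i ∈ s, f i) ⊓ y)
    (Set.range_nonempty _) ⟨y, by rintro _ ⟨n, rfl⟩; exact inf_le_right⟩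
  have hmono : Monotone fun s : Finset ι => ∑ i ∈ s, f i := fun s t hst =>
    Finset.sum_le_sum_of_subset_of_nonneg hst fun i _ _ => hf i
  refine ⟨Finset ι, inferInstance, inferInstance, inferInstance,
    fun s => u - (∑ i ∈ s, f i) ⊓ y, fun s t hst =>
      sub_le_sub_left (inf_le_inf_right y (hmono hst)) u, ⟨?_, fun w hw => ?_⟩,
      fun s => ⟨(s, s), fun p hp => ?_⟩⟩
  · rintro _ ⟨s, rfl⟩
    exact sub_nonneg.mpr (hu.1 ⟨s, rfl⟩)
  · have h : u ≤ u - w := by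
      refine hu.2 ?_
      rintro _ ⟨s, rfl⟩
      exact le_sub_comm.mp (hw ⟨s, rfl⟩)
    simpa using h
  · obtain ⟨p, q⟩ := p
    obtain ⟨hp, hq⟩ : s ≤ p ∧ s ≤ q := hp
    simp only [sub_zero]
    rw [abs_of_nonneg (le_inf (abs_nonneg _) hy)]
    set r : X := ∑ i ∈ (p ∪ q) \ s, f i with hr
    have hr0 : 0 ≤ r := Finset.sum_nonneg fun i _ => hf i
    have hs0 : 0 ≤ ∑ i ∈ s, f i := Finset.sum_nonneg fun i _ => hf i
    have hsum : r + ∑ i ∈ s, f i = ∑ i ∈ p ∪ q, f i :=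
      Finset.sum_sdiff (hp.trans Finset.subset_union_left)
    have hdis : r ⊓ ∑ i ∈ s, f i = 0 := by
      refine inf_sum_eq_zero hf hr0 s fun i hi => ?_
      rw [inf_comm]
      refine inf_sum_eq_zero hf (hf i) _ fun j hj => hd ?_
      rintro rfl
      exact (Finset.mem_sdiff.mp hj).2 hi
    have habs : |∑ i ∈ p, f i - ∑ i ∈ q, f i| ≤ r := by
      have hr' : r = ∑ i ∈ p ∪ q, f i - ∑ i ∈ s, f i := eq_sub_of_add_eq hsum
      rw [hr', abs_le', neg_sub]
      exact ⟨sub_le_sub (hmono Finset.subset_union_left) (hmono hq),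
        sub_le_sub (hmono Finset.subset_union_right) (hmono hp)⟩
    -- The truncations of `r` and of the sum over `s` are disjoint, so their sum is a supremum and
    -- stays below `u`.
    refine (inf_le_inf_right y habs).trans (le_sub_iff_add_le.mpr ?_)
    rw [add_eq_sup_of_inf_eq_zero
      (inf_eq_zero_mono (le_inf hr0 hy) (le_inf hs0 hy) inf_le_left inf_le_left hdis)]
    refine le_trans ?_ (hu.1 ⟨p ∪ q, rfl⟩)
    simp only [← hsum]
    exact sup_le (inf_le_inf_right y (le_add_of_nonneg_right hs0))
      (inf_le_inf_right y (le_add_of_nonneg_left hr0))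

omit [IsOrderedAddMonoid X] in
theorem UOConverges.nonpos_of_eventually_le {ι : Type v} [Preorder ι] [IsDirectedOrder ι]
    {x : ι → X} {l : X} (h : UOConverges x l) {w : X} (i₁ : ι)
    (hw : ∀ i, i₁ ≤ i → w ≤ |x i - l|) : w ≤ 0 := by
  -- Truncating at `w ⊔ 0` does not cut off `w`.
  obtain ⟨Γ, _, _, _, a, -, ha, hdom⟩ := h (w ⊔ 0) le_sup_right
  refine ha.2 ?_
  rintro _ ⟨γ, rfl⟩
  obtain ⟨i₀, hi₀⟩ := hdom γ
  obtain ⟨i, hi0, hi1⟩ := exists_ge_ge i₀ i₁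
  have h1 : w ≤ |x i - l| ⊓ (w ⊔ 0) := le_inf (hw i hi1) le_sup_left
  refine (h1.trans (le_abs_self _)).trans ?_
  simpa using hi₀ i hi0

theorem UOConverges.isLUB_of_monotone {ι : Type v} [Preorder ι] [IsDirectedOrder ι] [Nonempty ι]
    {x : ι → X} {l : X} (h : UOConverges x l) (hx : Monotone x) : IsLUB (Set.range x) l := by
  constructor
  · rintro _ ⟨i, rfl⟩
    refine sub_nonpos.mp (h.nonpos_of_eventually_le i fun j hj => ?_)
    exact (sub_le_sub_right (hx hj) l).trans (le_abs_self _)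
  · intro u hu
    refine sub_nonpos.mp (h.nonpos_of_eventually_le (Classical.arbitrary ι) fun j _ => ?_)
    rw [abs_sub_comm]
    exact (sub_le_sub_left (hu ⟨j, rfl⟩) l).trans (le_abs_self _)

/-- Finite disjoint sums are finite suprema, so they have the same upper bounds as the family. -/
theorem UOComplete.laterallyComplete (hX : OrderComplete X) (h : UOComplete.{u, u} X) :
    LaterallyComplete X := by
  classical
  intro A hA hpos hdis
  have hf : ∀ a : A, (0 : X) ≤ a := fun a => hpos a a.2
  have hd : Pairwise fun a b : A => (a : X) ⊓ b = 0 := fun a b hab => by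
    have : |(a : X)| ⊓ |(b : X)| = 0 := hdis a.2 b.2 (Subtype.coe_ne_coe.mpr hab)
    rwa [abs_of_nonneg (hf a), abs_of_nonneg (hf b)] at this
  obtain ⟨l, hl⟩ := h (Finset A) _ (hX.uoCauchy_sum hf hd)
  have hlub := hl.isLUB_of_monotone fun s t hst =>
    Finset.sum_le_sum_of_subset_of_nonneg hst fun i _ _ => hf i
  refine ⟨l, fun a ha => ?_, fun u hu => hlub.2 ?_⟩
  · simpa using hlub.1 ⟨{⟨a, ha⟩}, rfl⟩
  · rintro _ ⟨s, rfl⟩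
    induction s using Finset.induction_on with
    | empty =>
      obtain ⟨a, ha⟩ := hA
      simpa using (hpos a ha).trans (hu ha)
    | insert a s has ih =>
      simp only [Finset.sum_insert has]
      rw [add_eq_sup_of_inf_eq_zero (inf_sum_eq_zero hf (hf a) s fun b hb => hd ?_)]
      · exact sup_le (hu a.2) ih
      · rintro rfl
        exact has hb

end LateralCompleteness

/-! ### From universal completeness to uo-completeness -/

section UniversalCompleteness

variable {X : Type u} [AddCommGroup X] [Lattice X] [IsOrderedAddMonoid X]

/-- Take the supremum of a maximal disjoint family: a vector disjoint from it belongs to the family,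
hence lies below it. -/
theorem LaterallyComplete.exists_weak_unit (hX : LaterallyComplete X) :
    ∃ e : X, 0 ≤ e ∧ ∀ x, 0 ≤ x → x ⊓ e = 0 → x = 0 := by
  obtain ⟨A, hA⟩ := zorn_subset
    {A : Set X | (∀ a ∈ A, 0 ≤ a) ∧ A.Pairwise fun a b => |a| ⊓ |b| = 0} (by
      intro c hc hchain
      refine ⟨⋃₀ c, ⟨?_, ?_⟩, fun s hs => Set.subset_sUnion_of_mem hs⟩
      · rintro a ⟨s, hs, has⟩
        exact (hc hs).1 a has
      · exact (Set.pairwise_sUnion hchain.directedOn).mpr fun s hs => (hc hs).2)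
  have hins : ∀ x, 0 ≤ x → (∀ a ∈ A, x ⊓ a = 0) → x ∈ A := by
    intro x hx hxA
    refine hA.2 (y := insert x A) ⟨?_, ?_⟩ (Set.subset_insert x A) (Set.mem_insert x A)
    · rintro a (rfl | ha)
      · exact hx
      · exact hA.1.1 a ha
    · refine Set.pairwise_insert.mpr ⟨hA.1.2, fun a ha _ => ?_⟩
      rw [abs_of_nonneg hx, abs_of_nonneg (hA.1.1 a ha), inf_comm a x, hxA a ha]
      exact ⟨rfl, rfl⟩
  have h0 : (0 : X) ∈ A := hins 0 le_rfl fun a ha => inf_eq_left.mpr (hA.1.1 a ha)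
  obtain ⟨e, he⟩ := hX A ⟨0, h0⟩ hA.1.1 hA.1.2
  refine ⟨e, he.1 h0, fun x hx hxe => ?_⟩
  have hxA := hins x hx fun a ha => inf_eq_zero_mono hx (hA.1.1 a ha) le_rfl (he.1 ha) hxe
  rwa [inf_eq_left.mpr (he.1 hxA)] at hxe

/-- Bounds `g n` that hold on the increasing bands generated by `v (n + 1)` can be glued to a
single bound on all these bands. -/
theorem UniversallyComplete.exists_common_bound (hX : UniversallyComplete X) {v g : ℕ → X}
    (hv0 : v 0 = 0) (hv : Monotone v) (hg : ∀ n, 0 ≤ g n) :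
    ∃ h : X, ∀ s, (∀ n, ((s - g n) ⊔ 0) ⊓ v (n + 1) = 0) → ∀ n, ((s - h) ⊔ 0) ⊓ v n = 0 := by
  have hvn : ∀ n, 0 ≤ v n := fun n => hv0 ▸ hv (Nat.zero_le n)
  -- `p n - q n` is the part of `g n` on the band of `v (n + 1)` but off that of `v n`; these pieces
  -- are disjoint and `h` is their supremum.
  choose p hp0 hpg hpc hpd using fun n => hX.1.exists_band_component (hvn (n + 1)) (hg n)
  choose q hq0 hqp hqc hqd using fun n => hX.1.exists_band_component (hvn n) (hp0 n)
  have hk0 : ∀ n, 0 ≤ p n - q n := fun n => sub_nonneg.mpr (hqp n)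
  have hdis : ∀ m n, m < n → (p m - q m) ⊓ (p n - q n) = 0 := by
    intro m n hmn
    rw [inf_comm]
    refine inf_eq_zero_mono (hk0 n) (hk0 m) le_rfl (sub_le_self _ (hq0 m)) (hpd m _ (hk0 n) ?_)
    exact inf_eq_zero_mono (hk0 n) (hvn _) le_rfl (hv hmn) (hqc n)
  obtain ⟨h, hh⟩ := hX.2 (Set.range fun n => p n - q n) (Set.range_nonempty _)
    (by rintro _ ⟨n, rfl⟩; exact hk0 n) (by
      rintro _ ⟨m, rfl⟩ _ ⟨n, rfl⟩ hmn
      simp only [abs_of_nonneg (hk0 _)]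
      rcases lt_trichotomy m n with hlt | rfl | hlt
      · exact hdis m n hlt
      · exact absurd rfl hmn
      · rw [inf_comm]
        exact hdis n m hlt)
  refine ⟨h, fun s hs n => ?_⟩
  have hr0 : (0 : X) ≤ (s - h) ⊔ 0 := le_sup_right
  induction n with
  | zero => rw [hv0]; exact inf_eq_right.mpr hr0
  | succ n ih =>
    -- `t` is disjoint from `(s - g n)⁺`, `g n - p n` and `q n` but lies below their sum, so it
    -- vanishes.
    set t := ((s - h) ⊔ 0) ⊓ v (n + 1) with ht
    have ht0 : 0 ≤ t := le_inf hr0 (hvn _)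
    have h1 : t ⊓ ((s - g n) ⊔ 0) = 0 := by
      rw [inf_comm]
      exact inf_eq_zero_mono le_sup_right ht0 le_rfl inf_le_right (hs n)
    have h2 : t ⊓ (g n - p n) = 0 := by
      rw [inf_comm]
      exact inf_eq_zero_mono (sub_nonneg.mpr (hpg n)) ht0 le_rfl inf_le_right (hpc n)
    have h3 : t ⊓ q n = 0 :=
      inf_eq_zero_mono ht0 (hq0 n) inf_le_left le_rfl (hqd n _ hr0 ih)
    have h4 := inf_add_eq_zero ht0 (sub_nonneg.mpr (hpg n)) (hq0 n) h2 h3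
    have h5 := inf_add_eq_zero ht0 le_sup_right
      (add_nonneg (sub_nonneg.mpr (hpg n)) (hq0 n)) h1 h4
    rwa [inf_eq_left.mpr] at h5
    refine inf_le_left.trans (sup_le ?_ (add_nonneg le_sup_right
      (add_nonneg (sub_nonneg.mpr (hpg n)) (hq0 n))))
    calc s - h ≤ s - (p n - q n) := sub_le_sub_left (hh.1 ⟨n, rfl⟩) s
      _ = (s - g n) + (g n - p n + q n) := by abel
      _ ≤ _ := add_le_add_left le_sup_left _

/-- A sequence that is uniformly Cauchy with respect to `b ↓ 0`, after truncation at a weak unit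
`e`, is order bounded. -/
theorem UniversallyComplete.exists_bound_of_cauchy (hX : UniversallyComplete X) {e : X}
    (he : 0 ≤ e) (hunit : ∀ x, 0 ≤ x → x ⊓ e = 0 → x = 0) {b : ℕ → X} (hb : Antitone b)
    (hb0 : IsGLB (Set.range b) 0) {y : ℕ → X}
    (hy : ∀ n m, n ≤ m → |y m - y n| ⊓ e ≤ b n) : ∃ h, ∀ m, |y m| ≤ h := by
  have hbn : ∀ n, 0 ≤ b n := fun n => hb0.1 ⟨n, rfl⟩
  -- The shift by one makes `v 0 = 0`, where the gluing induction starts.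
  let v : ℕ → X := fun n => Nat.casesOn n 0 fun n => (e - b n) ⊔ 0
  have hv : Monotone v := by
    refine monotone_nat_of_le_succ fun n => ?_
    cases n with
    | zero => exact le_sup_right
    | succ n => exact sup_le_sup_right (sub_le_sub_left (hb n.le_succ) e) 0
  obtain ⟨h, hh⟩ := hX.exists_common_bound (v := v)
    (g := fun n => ∑ i ∈ Finset.range (n + 1), |y i| + e) rfl hv
    fun n => add_nonneg (Finset.sum_nonneg fun i _ => abs_nonneg _) he
  refine ⟨h, fun m => ?_⟩
  have hr0 : (0 : X) ≤ (|y m| - h) ⊔ 0 := le_sup_right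
  have hr : ∀ n, ((|y m| - h) ⊔ 0) ⊓ v n = 0 := by
    refine hh _ fun n => ?_
    have hle : ∀ i, i ≤ n → |y i| ≤ ∑ j ∈ Finset.range (n + 1), |y j| := fun i hi =>
      Finset.single_le_sum (f := fun j => |y j|) (fun j _ => abs_nonneg _)
        (Finset.mem_range.mpr (Nat.lt_succ_of_le hi))
    -- For `m ≤ n` the term `|y m|` is a summand of `g n`, which is why `g n` sums over all `i ≤ n`.
    rcases le_total n m with hnm | hmn
    · refine inf_eq_zero_mono le_sup_right le_sup_right
        (sup_le_sup_right (b := |y m - y n| - e) ?_ 0)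
        (y' := (e - |y m - y n|) ⊔ 0) ?_ ?_
      · have h1 : |y m| ≤ |y n| + |y m - y n| := by
          simpa using abs_add_le (y n) (y m - y n)
        rw [sub_le_iff_le_add]
        refine h1.trans ((add_le_add_left (hle n le_rfl) _).trans (le_of_eq ?_))
        abel
      · refine sup_le ?_ le_sup_right
        refine (sub_le_sub_left (hy n m hnm) e).trans (le_of_eq ?_)
        rw [sub_inf, sub_self]
      · have := posPart_inf_negPart_eq_zero (|y m - y n| - e)
        rwa [posPart_def, negPart_def, neg_sub] at this
    · have h1 : (|y m| - (∑ i ∈ Finset.range (n + 1), |y i| + e)) ⊔ 0 = 0 :=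
        sup_eq_right.mpr (sub_nonpos.mpr ((hle m hmn).trans (le_add_of_nonneg_right he)))
      simp only [h1]
      exact inf_eq_left.mpr le_sup_right
  have hzero : (|y m| - h) ⊔ 0 = 0 := by
    refine hunit _ hr0 (le_antisymm (hb0.2 ?_) (le_inf hr0 he))
    rintro _ ⟨n, rfl⟩
    calc ((|y m| - h) ⊔ 0) ⊓ e ≤ ((|y m| - h) ⊔ 0) ⊓ (v (n + 1) + b n) :=
          inf_le_inf_left _ (sub_le_iff_le_add.mp le_sup_left)
      _ ≤ ((|y m| - h) ⊔ 0) ⊓ v (n + 1) + ((|y m| - h) ⊔ 0) ⊓ b n :=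
          inf_add_le_add_inf hr0 le_sup_right (hbn n)
      _ ≤ b n := (add_le_add (hr (n + 1)).le inf_le_right).trans_eq (zero_add _)
  exact sub_nonpos.mp (sup_eq_right.mp hzero)

/-- `l` is the limit inferior. The free `z` lets estimates against a tail of the sequence pass to
members of the net. -/
theorem OrderComplete.exists_limit_of_bounded (hX : OrderComplete X) {y : ℕ → X} {h : X}
    (hy : ∀ m, |y m| ≤ h) :
    ∃ l, ∀ z c n, (∀ m, n ≤ m → |z - y m| ≤ c) → |z - l| ≤ c := by
  obtain ⟨l, hl⟩ := hX.exists_isLUB (A := {w | ∃ n, ∀ m, n ≤ m → w ≤ y m})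
    ⟨-h, 0, fun m _ => neg_le.mp ((neg_le_abs _).trans (hy m))⟩
    ⟨h, by rintro w ⟨n, hn⟩; exact (hn n le_rfl).trans ((le_abs_self _).trans (hy n))⟩
  refine ⟨l, fun z c n hn => abs_le'.mpr ⟨?_, ?_⟩⟩
  · rw [sub_le_comm]
    exact hl.1 ⟨n, fun m hm => sub_le_comm.mp ((le_abs_self _).trans (hn m hm))⟩
  · rw [neg_sub, sub_le_iff_le_add]
    refine hl.2 ?_
    rintro w ⟨k, hk⟩
    refine (hk (max n k) (le_max_right _ _)).trans (sub_le_iff_le_add.mp ?_)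
    rw [← neg_sub]
    exact (neg_le_abs _).trans (hn _ (le_max_left _ _))

theorem CountableSupProperty.exists_seq_isGLB (hX : CountableSupProperty X) {Γ : Type*}
    [Nonempty Γ] {a : Γ → X} (ha : IsGLB (Set.range a) 0) :
    ∃ c : ℕ → Γ, IsGLB (Set.range (a ∘ c)) 0 := by
  obtain ⟨C, hCA, hC, hlub⟩ := hX (Set.range fun γ => -a γ) 0 ⟨by
      rintro _ ⟨γ, rfl⟩
      exact neg_nonpos.mpr (ha.1 ⟨γ, rfl⟩), fun w hw => by
      rw [← neg_nonpos]
      refine ha.2 ?_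
      rintro _ ⟨γ, rfl⟩
      exact neg_le.mp (hw ⟨γ, rfl⟩)⟩
  let γ₀ : Γ := Classical.arbitrary Γ
  -- `C` may be empty; the extra element makes it the range of a sequence.
  obtain ⟨f, hf⟩ := (hC.insert (-a γ₀)).exists_eq_range (Set.insert_nonempty _ _)
  have hfr : ∀ n, ∃ γ, -a γ = f n := fun n => by
    have : f n ∈ insert (-a γ₀) C := hf ▸ ⟨n, rfl⟩
    rcases this with h | h
    · exact ⟨γ₀, h.symm⟩
    · exact hCA h
  choose c hc using hfr
  refine ⟨c, ?_, fun w hw => ?_⟩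
  · rintro _ ⟨n, rfl⟩
    exact ha.1 ⟨c n, rfl⟩
  · rw [← neg_nonneg]
    refine hlub.2 fun z hz => ?_
    obtain ⟨n, rfl⟩ : z ∈ Set.range f := hf ▸ Set.mem_insert_of_mem _ hz
    rw [← hc n]
    exact neg_le_neg (hw ⟨n, rfl⟩)

/-- Control of a truncation at a weak unit by `b ↓ 0` yields uo-convergence. -/
theorem OrderComplete.uoConverges_of_weak_unit (hX : OrderComplete X) {e : X}
    (he : 0 ≤ e) (hunit : ∀ x, 0 ≤ x → x ⊓ e = 0 → x = 0) {b : ℕ → X}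
    (hb0 : IsGLB (Set.range b) 0) {ι : Type v} [Preorder ι] {x : ι → X} {l : X} {i₀ : ℕ → ι}
    (hi₀ : Monotone i₀) (hx : ∀ n i, i₀ n ≤ i → |x i - l| ⊓ e ≤ b n) : UOConverges x l := by
  intro y hy
  have hne : ∀ n, ((fun i => |x i - l| ⊓ y) '' Set.Ici (i₀ n)).Nonempty := fun n =>
    ⟨_, i₀ n, Set.mem_Ici.mpr le_rfl, rfl⟩
  choose d hd using fun n => hX.exists_isLUB (hne n)
    ⟨y, by rintro _ ⟨i, _, rfl⟩; exact inf_le_right⟩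
  have hd0 : ∀ n, 0 ≤ d n := fun n =>
    (le_inf (abs_nonneg _) hy).trans ((hd n).1 ⟨i₀ n, Set.mem_Ici.mpr le_rfl, rfl⟩)
  refine ⟨ULift ℕ, inferInstance, inferInstance, inferInstance, fun n => d n.down,
    fun m n hmn => ?_, ⟨?_, fun w hw => ?_⟩, fun n => ⟨i₀ n.down, fun i hi => ?_⟩⟩
  · exact (hd _).mono (hd _) (Set.image_mono (Set.Ici_subset_Ici.mpr (hi₀ hmn)))
  · rintro _ ⟨n, rfl⟩
    exact hd0 _
  -- By distributivity `d n ⊓ e ≤ b n`, so `(w ⊔ 0) ⊓ e` is below every `b n`.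
  · have h0 : w ⊔ 0 = 0 := by
      refine hunit _ le_sup_right (le_antisymm (hb0.2 ?_) (le_inf le_sup_right he))
      rintro _ ⟨n, rfl⟩
      refine (inf_le_inf_right e (sup_le (hw ⟨⟨n⟩, rfl⟩) (hd0 n))).trans
        (inf_le_of_isLUB (hd n) ?_)
      rintro _ ⟨i, hi, rfl⟩
      exact (inf_le_inf_right e inf_le_left).trans (hx n i hi)
    exact sup_eq_right.mp h0
  · rw [sub_zero, abs_of_nonneg (le_inf (abs_nonneg _) hy)]
    exact (hd n.down).1 ⟨i, hi, rfl⟩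

theorem exists_monotone_seq_ge {Γ : Type*} [Preorder Γ] [IsDirectedOrder Γ] (c : ℕ → Γ) :
    ∃ f : ℕ → Γ, Monotone f ∧ ∀ n, c n ≤ f n := by
  choose k hk₁ hk₂ using fun a b : Γ => exists_ge_ge a b
  let f : ℕ → Γ := fun n => Nat.rec (c 0) (fun n r => k r (c (n + 1))) n
  refine ⟨f, monotone_nat_of_le_succ fun n => hk₁ _ _, fun n => ?_⟩
  cases n with
  | zero => exact le_rfl
  | succ n => exact hk₂ _ _

theorem UniversallyComplete.uoComplete (hX : UniversallyComplete X)
    (hc : CountableSupProperty X) : UOComplete.{u, v} X := by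
  intro ι _ _ _ x hx
  obtain ⟨e, he, hunit⟩ := hX.2.exists_weak_unit
  obtain ⟨Γ, _, _, _, a, ha, ha0, hdom⟩ := hx e he
  obtain ⟨c, hca⟩ := hc.exists_seq_isGLB ha0
  obtain ⟨f, hf, hcf⟩ := exists_monotone_seq_ge c
  have hb : Antitone (a ∘ f) := fun m n hmn => ha (hf hmn)
  have hb0 : IsGLB (Set.range (a ∘ f)) 0 := by
    refine ⟨?_, fun w hw => hca.2 ?_⟩
    · rintro _ ⟨n, rfl⟩
      exact ha0.1 ⟨f n, rfl⟩
    · rintro _ ⟨n, rfl⟩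
      exact (hw ⟨n, rfl⟩).trans (ha (hcf n))
  choose p hp using fun n => hdom (f n)
  choose j hj₁ hj₂ using fun n => exists_ge_ge (p n).1 (p n).2
  obtain ⟨i₀, hi₀, hji⟩ := exists_monotone_seq_ge j
  have hcauchy : ∀ n i k, i₀ n ≤ i → i₀ n ≤ k → |x i - x k| ⊓ e ≤ (a ∘ f) n := by
    intro n i k hi hk
    refine (le_abs_self _).trans ?_
    simpa using hp n (i, k) ⟨(hj₁ n).trans ((hji n).trans hi), (hj₂ n).trans ((hji n).trans hk)⟩
  obtain ⟨h, hh⟩ := hX.exists_bound_of_cauchy he hunit hb hb0 (y := fun n => x (i₀ n))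
    fun n m hnm => hcauchy n _ _ (hi₀ hnm) le_rfl
  obtain ⟨l, hl⟩ := hX.1.exists_limit_of_bounded hh
  refine ⟨l, hX.1.uoConverges_of_weak_unit he hunit hb0 hi₀ fun n i hi => ?_⟩
  -- The Cauchy estimate holds only after truncation at `e`, so the limit is taken against the
  -- supremum `s` of the untruncated differences, truncated afterwards by distributivity.
  obtain ⟨s, hs⟩ := hX.1.exists_isLUB
    (A := (fun m => |x i - x (i₀ m)|) '' Set.Ici n) ⟨_, n, Set.mem_Ici.mpr le_rfl, rfl⟩
    ⟨|x i| + h, by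
      rintro _ ⟨m, _, rfl⟩
      simp only [sub_eq_add_neg]
      exact (abs_add_le _ _).trans (add_le_add le_rfl ((abs_neg _).trans_le (hh m)))⟩
  refine (inf_le_inf_right e (hl _ s n fun m hm => hs.1 ⟨m, hm, rfl⟩)).trans
    (inf_le_of_isLUB hs ?_)
  rintro _ ⟨m, hm, rfl⟩
  exact hcauchy n i _ hi (hi₀ hm)

end UniversalCompleteness

end VLat

/-- In the first part only nets with index sets in the universe of `X` are assumed to be handled;
in the second part the index sets may lie in any universe. -/
theorem proposition2p7 (X : Type u) [AddCommGroup X] [Lattice X] [IsOrderedAddMonoid X]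
    [Module ℝ X] [IsOrderedModule ℝ X] (hX : VLat.OrderComplete X) :
    (VLat.UOComplete.{u, u} X → VLat.UniversallyComplete X) ∧
      (VLat.UniversallyComplete X → VLat.CountableSupProperty X → VLat.UOComplete.{u, v} X) :=
  ⟨fun h => ⟨hX, h.laterallyComplete hX⟩, fun h hc => h.uoComplete hc⟩
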